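/- Let $n\ge 0$ and let $G$ be a simple graph on $V=\{1,\dots,n\}$ with complement $\overline G$; for $n=0$ read $n-1$ and $k-1$ below as $0$. For a graph $H$ on $V$, let $\widetilde H$ be the graph on $\{0,1,\dots,n\}$ obtained from $H$ by joining a new vertex $0$ to all vertices of $V$. A spanning tree $T$ of $\widetilde H$ is always regarded as a directed graph, with every edge directed toward the root $0$; deleting $0$ turns it into a rooted spanning forest of $H$, whose roots are the $u$ with $(u,0)\in T$. Call $x$ a child of $u$ in $T$ if there is a nontrivial directed path from $x$ to $u$. A valid pair of a spanning tree $T$ of $\widetilde{K_n}$ is a directed edge $(u,v)\in T$ with $v\neq 0$. An operational set of $T$ is a set $O$ of valid pairs of $T$ that contains every valid pair that is not an edge of $\overline G$. Let $\mathbf A$ be the set of pairs $(T,O)$ with $T$ a spanning tree of $\widetilde{K_n}$ and $O$ an operational set of $T$. Let $\mathbf B$ be the set of pairs $(F,W)$ with $F$ a spanning tree of $\widetilde{\overline G}$ and $W$ a sequence of length $k-1$ with entries in $\{0,1,\dots,n\}$, where $k$ is the number of connected components of the forest $F\setminus\{0\}$. Algorithm $\varphi$, on input $(T,O)\in\mathbf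 A$: let $S$ be the set of $u$ whose outgoing edge $(u,v)\in T$ satisfies $(u,v)\in O$ or $v=0$; let $W$ be the empty sequence and $F$ a copy of $T$. While $|S|>1$: (1) as long as $T$ has a leaf $u\ne0$ not in $S$, choose any such leaf and remove it from $T$ together with its edge; (2) when all leaves $u\neq 0$ of $T$ lie in $S$, let $u^*$ be the largest of them and $(u^*,v^*)$ its edge; remove $u^*$ and this edge from $T$, delete $u^*$ from $S$, append $v^*$ to $W$, and replace $(u^*,v^*)$ by $(u^*,0)$ in $F$. Output $(F,W)$. Algorithm $\psi$, on input $(F,W)\in\mathbf B$: let $R$ be the set of roots of the forest and $O=\emptyset$. While $W$ is not empty: let $w$ be its first element and $u$ the largest element of $R$ such that no element of $W$ is equal to $u$ or is a child of $u$ in $F$; delete $w$ from the front of $W$ and $u$ from $R$, replace the edge $(u,0)$ of $F$ by $(u,w)$, and if $w\neq0$ add $(u,w)$ to $O$. Output $(F,O)$. Theorem. For every $G$, every execution of $\varphi$ on an element of $\mathbf A$ terminates, and its output is an element of $\mathbf B$ that does not depend on the choices made in (1); every execution of $\psi$ on an element of $\mathbf B$ terminates, with output in $\mathbf A$; and the resulting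 maps $\varphi:\mathbf A\to\mathbf B$ and $\psi:\mathbf B\to\mathbf A$ are mutually inverse bijections. Moreover, for $G=K_n$ the map $\varphi$ is Prüfer coding of the spanning trees of $K_{n+1}$ (on the labels $0,1,\dots,n$): each spanning tree $T$ of $\widetilde{K_n}=K_{n+1}$ has exactly one operational set, the set of all its valid pairs; $\mathbf B$ consists of the pairs $(F_0,W)$, where $F_0$ is the star with all edges $(v,0)$, $v\in V$, and $W$ is any sequence of length $n-1$ in $\{0,\dots,n\}$; and for every spanning tree $T$, $\varphi$ outputs $(F_0,W)$ with $W$ the Prüfer code of $T$ with respect to the reversed order of the labels. That is, after relabelling $i\mapsto n-i$ in $T$ and in $W$, $W$ is the sequence obtained by repeatedly removing the smallest leaf of the tree and writing down its neighbour, until at most two vertices remain. -/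

import Mathlib

namespace ForestReciprocity

/-- The extended graph of a graph `G` on the vertices `1, …, n`: the vertex `i` of `G` is
`Fin.succ i`, and the new vertex `0` is joined to every other vertex. -/
def extendedGraph {n : ℕ} (G : SimpleGraph (Fin n)) : SimpleGraph (Fin (n + 1)) :=
  G.map (Fin.succEmb n) ⊔ SimpleGraph.fromRel (fun a _ => a = 0)

/-- A set of directed edges on the vertices `0, 1, …, n`. -/
abbrev Arcs (n : ℕ) : Type := Finset (Fin (n + 1) × Fin (n + 1))

open Classical in
/-- The edges of a tree `T` on `0, 1, …, n`, each directed toward the root `0`. -/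
noncomputable def arcsToRoot {n : ℕ} (T : SimpleGraph (Fin (n + 1))) : Arcs n :=
  Finset.univ.filter (fun e => T.Adj e.1 e.2 ∧ T.dist e.2 0 < T.dist e.1 0)

/-- `D` is a spanning tree of the extended graph of `G` (equivalently, a rooted spanning forest
of `G`), regarded as a directed graph with all edges pointing toward the root `0`. -/
def IsRootedTree {n : ℕ} (G : SimpleGraph (Fin n)) (D : Arcs n) : Prop :=
  ∃ T : SimpleGraph (Fin (n + 1)), T.IsTree ∧ T ≤ extendedGraph G ∧ D = arcsToRoot T

/-- The forest on the vertices `1, …, n` obtained by removing the vertex `0`. -/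
def forest {n : ℕ} (D : Arcs n) : SimpleGraph (Fin n) :=
  SimpleGraph.fromRel (fun i j => (i.succ, j.succ) ∈ D)

/-- The valid pairs of `D`: the directed edges of its forest. -/
def validPairs {n : ℕ} (D : Arcs n) : Arcs n :=
  D.filter (fun e => e.1 ≠ 0 ∧ e.2 ≠ 0)

open Classical in
/-- The valid pairs that are not edges of the complement of `G`. -/
noncomputable def forcedPairs {n : ℕ} (G : SimpleGraph (Fin n)) (D : Arcs n) : Arcs n :=
  (validPairs D).filter (fun e => ¬ (Gᶜ.map (Fin.succEmb n)).Adj e.1 e.2)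

/-- Operational sets of `D`: the forced pairs together with an arbitrary set `C` of other
valid pairs. -/
def IsOperationalSet {n : ℕ} (G : SimpleGraph (Fin n)) (D O : Arcs n) : Prop :=
  ∃ C : Arcs n, C ⊆ validPairs D \ forcedPairs G D ∧ O = C ∪ forcedPairs G D

/-- Pairs (rooted spanning forest of the complete graph, operational set). -/
def setA {n : ℕ} (G : SimpleGraph (Fin n)) : Set (Arcs n × Arcs n) :=
  {p | IsRootedTree (⊤ : SimpleGraph (Fin n)) p.1 ∧ IsOperationalSet G p.1 p.2}

/-- Pairs (rooted spanning forest of the complement of `G` with `k` components,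
sequence of length `k - 1` with entries in `{0, 1, …, n}`). -/
def setB {n : ℕ} (G : SimpleGraph (Fin n)) : Set (Arcs n × List (Fin (n + 1))) :=
  {p | IsRootedTree Gᶜ p.1 ∧
    p.2.length = Nat.card (forest p.1).ConnectedComponent - 1}

/-- Every execution of the (possibly nondeterministic) program `step` from the state `s`
terminates, does so in a state satisfying the exit condition `final`, and outputs `b`. -/
def Computes {σ β : Type} (step : σ → σ → Prop) (final : σ → Prop) (out : σ → β)
    (s : σ) (b : β) : Prop :=
  Acc (fun t' t => step t t') s ∧
    ∀ t, Relation.ReflTransGen step s t → (∀ t', ¬ step t t') → final t ∧ out t = b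

/-- `u ≠ 0` is a leaf of `D`: exactly one edge of `D` is incident to `u`. -/
def IsLeaf {n : ℕ} (D : Arcs n) (u : Fin (n + 1)) : Prop :=
  u ≠ 0 ∧ (D.filter (fun e => e.1 = u ∨ e.2 = u)).card = 1

/-- The variables of the algorithm `φ`: the shrinking tree, the set `S`, the sequence `W`
and the forest `F` under construction. A nonzero vertex belongs to the shrinking tree iff one of
its edges does, so a leaf is removed by erasing its edge. -/
structure PhiState (n : ℕ) where
  tree : Arcs n
  S : Finset (Fin (n + 1))
  W : List (Fin (n + 1))
  F : Arcs n

/-- One elementary step in the loop `while |S| > 1` of the algorithm `φ`. -/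
inductive PhiStep {n : ℕ} : PhiState n → PhiState n → Prop
  /-- Remove any leaf that is not in `S`. -/
  | prune (s : PhiState n) (u v : Fin (n + 1)) (hS : 1 < s.S.card)
      (hleaf : IsLeaf s.tree u) (hu : u ∉ s.S) (huv : (u, v) ∈ s.tree) :
      PhiStep s { s with tree := s.tree.erase (u, v) }
  /-- When all leaves are in `S`: remove the largest leaf `u` with its edge `(u, v)`, delete `u`
  from `S`, append `v` to `W`, and replace `(u, v)` by `(u, 0)` in `F`. -/
  | record (s : PhiState n) (u v : Fin (n + 1)) (hS : 1 < s.S.card)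
      (hall : ∀ x, IsLeaf s.tree x → x ∈ s.S)
      (hu : IsGreatest {x | IsLeaf s.tree x} u) (huv : (u, v) ∈ s.tree) :
      PhiStep s
        { tree := s.tree.erase (u, v)
          S := s.S.erase u
          W := s.W ++ [v]
          F := insert (u, 0) (s.F.erase (u, v)) }

/-- The initial state of `φ`: `S` consists of the tails of the pairs of `O` in the tree and of the
tails of the edges into `0`. -/
def phiInit {n : ℕ} (a : Arcs n × Arcs n) : PhiState n where
  tree := a.1
  S := (a.1.filter (fun e => e ∈ a.2 ∨ e.2 = 0)).image Prod.fst
  W := []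
  F := a.1

/-- The algorithm `φ` on input `a` always terminates, with output `b`. -/
def PhiComputes {n : ℕ} (a : Arcs n × Arcs n) (b : Arcs n × List (Fin (n + 1))) : Prop :=
  Computes PhiStep (fun s => s.S.card ≤ 1) (fun s => (s.F, s.W)) (phiInit a) b

/-- There is a nontrivial directed path from `x` to `u` in `D`. -/
def IsChild {n : ℕ} (D : Arcs n) (x u : Fin (n + 1)) : Prop :=
  Relation.TransGen (fun a b => (a, b) ∈ D) x u

/-- The variables of the algorithm `ψ`. -/
structure PsiState (n : ℕ) where
  F : Arcs n
  W : List (Fin (n + 1))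
  R : Finset (Fin (n + 1))
  O : Arcs n

/-- One pass through the loop `while W is nonempty` of the algorithm `ψ`: `w` is the first element
of `W`, and `u` is the largest element of `R` such that no element of `W` is `u` or a child
of `u`. -/
inductive PsiStep {n : ℕ} : PsiState n → PsiState n → Prop
  | attach (s : PsiState n) (w : Fin (n + 1)) (W' : List (Fin (n + 1))) (u : Fin (n + 1))
      (hW : s.W = w :: W')
      (hu : IsGreatest {y | y ∈ s.R ∧ ∀ x ∈ s.W, x ≠ y ∧ ¬ IsChild s.F x y} u) :
      PsiStep s
        { F := insert (u, w) (s.F.erase (u, 0))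
          W := W'
          R := s.R.erase u
          O := if w ≠ 0 then insert (u, w) s.O else s.O }

/-- The initial state of `ψ`: `R` is the set of roots of the forest. -/
def psiInit {n : ℕ} (b : Arcs n × List (Fin (n + 1))) : PsiState n where
  F := b.1
  W := b.2
  R := (b.1.filter (fun e => e.2 = 0)).image Prod.fst
  O := ∅

/-- The algorithm `ψ` on input `b` always terminates, with output `a`. -/
def PsiComputes {n : ℕ} (b : Arcs n × List (Fin (n + 1))) (a : Arcs n × Arcs n) : Prop :=
  Computes PsiStep (fun s => s.W = []) (fun s => (s.F, s.O)) (psiInit b) a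

/-- The directed tree in which every vertex `1, …, n` points to `0`
(the forest without edges). -/
def starArcs (n : ℕ) : Arcs n :=
  Finset.univ.filter (fun e => e.1 ≠ 0 ∧ e.2 = 0)

/-- `c` is the Prüfer code of the subtree of `T` on the vertex set `X`: as long as
more than two vertices remain, remove the smallest leaf and write down its neighbour. -/
inductive IsPruferCode {V : Type} [LinearOrder V] (T : SimpleGraph V) :
    Finset V → List V → Prop
  | done (X : Finset V) (hX : X.card ≤ 2) : IsPruferCode T X []
  | remove (X : Finset V) (u v : V) (c : List V) (hX : 2 < X.card)
      (hu : IsLeast {x | x ∈ X ∧ ∃! y, y ∈ X ∧ T.Adj x y} u)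
      (hv : v ∈ X) (huv : T.Adj u v) (hc : IsPruferCode T (X.erase u) c) :
      IsPruferCode T X (v :: c)

end ForestReciprocity

open ForestReciprocity

/-!
Trees on `0, …, n` directed toward `0` are handled through their parent maps `p`
(`isRootedTree_iff` identifies the two notions), and both algorithms are compared with one
recursion, `Code p S W`, in which the tree does not change: as long as `S` has more than one
element, delete from `S` the largest vertex that has no other vertex of `S` in its subtree, and
append its parent to `W`.

In `φ`, the shrinking tree is always the subtree on a set of vertices that contains `S` and is
closed under taking parents. Once all its leaves lie in `S`, the leaves are exactly the vertices
of `S` with no other vertex of `S` in their subtree (`IsParentClosed.leaves_eq`), whatever the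
order of pruning; so `φ` outputs the code `W` and the tree `cut p S`, in which all of `S` has been
redirected to `0` (`Code.phiComputes`). The initial `S` contains every root, and this makes the
last remaining vertex a root, which needs no redirection.

In `ψ`, the current forest is always `cut p R`, where `R` is the set of roots still to be
attached. The remaining entries of `W` are the parents in the full tree of the vertices of `R`,
except for the parent `0` of the last one. Therefore a vertex `u ∈ R` has no entry of `W` in its
current subtree iff it has no other vertex of `R` in its full subtree (`minimalVertices_eq`), and
`ψ` retraces the recursion (`Code.psiComputes`). Conversely, given a forest with root set `R` and
`|R| - 1` letters, each letter lies in the subtree of at most one root, so that some root is free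
to be attached to the first letter without creating a cycle; by induction every word of the right
length is a code (`exists_cut_eq_code`).

Hence every element of `setA G` has a partner in `setB G`, and vice versa, such that `φ` computes
the second from the first and `ψ` the first from the second. As outputs are unique, the two maps
are mutually inverse. For the complete graph `S` consists of all nonzero vertices, nothing is
pruned, and the recursion is that of the Prüfer code with the order of the labels reversed
(`Code.isPruferCode`).
-/

open ForestReciprocity

namespace ForestReciprocity

variable {n : ℕ} {p q : Fin (n + 1) → Fin (n + 1)}

/-! ### Parent maps -/

/-- The arcs `u → p u` from the nonzero vertices to their parents. The value `p 0` is irrelevant. -/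
def arcsOf (p : Fin (n + 1) → Fin (n + 1)) : Arcs n :=
  Finset.univ.filter (fun e => e.1 ≠ 0 ∧ e.2 = p e.1)

@[simp] lemma mem_arcsOf {a b : Fin (n + 1)} :
    (a, b) ∈ arcsOf p ↔ a ≠ 0 ∧ b = p a := by
  simp [arcsOf]

/-- `p` is the parent map of a tree rooted at `0`. This is encoded as well-foundedness of
"`b` is the parent of `a`", which on a finite vertex set excludes exactly the directed cycles. -/
def IsRooted (p : Fin (n + 1) → Fin (n + 1)) : Prop :=
  WellFounded (fun b a => (a, b) ∈ arcsOf p)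

lemma IsRooted.induction (hp : IsRooted p) {C : Fin (n + 1) → Prop} (h0 : C 0)
    (h : ∀ u, u ≠ 0 → C (p u) → C u) (u : Fin (n + 1)) : C u := by
  induction u using WellFounded.induction hp with
  | _ u ih =>
    by_cases hu : u = 0
    · exact hu ▸ h0
    · exact h u hu (ih _ (by simp [hu]))

lemma IsRooted.not_isChild_self (hp : IsRooted p) (u : Fin (n + 1)) :
    ¬ IsChild (arcsOf p) u u := fun h => by
  have h' : Relation.TransGen (fun b a => (a, b) ∈ arcsOf p) u u := by
    rw [← Relation.transGen_swap]; exact h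
  exact hp.transGen.irrefl.irrefl u h'

lemma IsRooted.ne_parent (hp : IsRooted p) {u : Fin (n + 1)} (hu : u ≠ 0) : p u ≠ u := fun h =>
  hp.not_isChild_self u (.single (by simp [hu, h]))

lemma not_isChild_zero (u : Fin (n + 1)) : ¬ IsChild (arcsOf p) 0 u := fun h => by
  obtain ⟨b, hb, -⟩ := Relation.TransGen.head'_iff.1 h
  simp at hb

lemma acc_zero (p : Fin (n + 1) → Fin (n + 1)) : Acc (fun b a => (a, b) ∈ arcsOf p) 0 :=
  ⟨_, fun y hy => by simp at hy⟩

/-- Directed paths can be followed backwards only finitely often. -/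
lemma IsRooted.wellFounded_isChild (hp : IsRooted p) :
    WellFounded (fun a b => IsChild (arcsOf p) a b) := by
  have h1 : IsTrans (Fin (n + 1)) (fun a b => IsChild (arcsOf p) a b) :=
    ⟨fun a b c h h' => Relation.TransGen.trans h h'⟩
  have h2 : Std.Irrefl (fun a b => IsChild (arcsOf p) a b) := ⟨hp.not_isChild_self⟩
  exact Finite.wellFounded_of_trans_of_irrefl _

lemma eq_of_mem_arcsOf {a b c : Fin (n + 1)} (h : (a, b) ∈ arcsOf p) (h' : (a, c) ∈ arcsOf p) :
    b = c := by
  rw [mem_arcsOf] at h h'; rw [h.2, h'.2]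

/-- A vertex lies in the tree of at most one root. -/
lemma root_unique {x r s : Fin (n + 1)} (hr : r ≠ 0) (hs : s ≠ 0) (hpr : p r = 0) (hps : p s = 0)
    (hxr : Relation.ReflTransGen (fun a b => (a, b) ∈ arcsOf p) x r)
    (hxs : Relation.ReflTransGen (fun a b => (a, b) ∈ arcsOf p) x s) : r = s := by
  have key : ∀ r s : Fin (n + 1), s ≠ 0 → p r = 0 →
      Relation.ReflTransGen (fun a b => (a, b) ∈ arcsOf p) r s → r = s := by
    intro r s hs hpr h
    rcases Relation.ReflTransGen.cases_head h with h | ⟨c, hc, h⟩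
    · exact h
    · rw [mem_arcsOf, hpr] at hc
      rw [hc.2] at h
      rcases Relation.ReflTransGen.cases_head h with h | ⟨d, hd, h⟩
      · exact absurd h.symm hs
      · simp at hd
  rcases Relation.ReflTransGen.total_of_right_unique
    (r := fun a b => (a, b) ∈ arcsOf p) (fun a b c h h' => eq_of_mem_arcsOf h h') hxr hxs with h | h
  · exact key r s hs hpr h
  · exact (key s r hr hps h).symm

/-! ### Parent maps and rooted trees -/

/-- The undirected graph underlying `arcsOf p`. -/
def arcGraph (p : Fin (n + 1) → Fin (n + 1)) : SimpleGraph (Fin (n + 1)) :=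
  SimpleGraph.fromRel (fun a b => (a, b) ∈ arcsOf p)

lemma IsRooted.arcGraph_adj (hp : IsRooted p) {a b : Fin (n + 1)} :
    (arcGraph p).Adj a b ↔ (a ≠ 0 ∧ b = p a) ∨ (b ≠ 0 ∧ a = p b) := by
  simp only [arcGraph, SimpleGraph.fromRel_adj, mem_arcsOf, and_iff_right_iff_imp]
  rintro (⟨h, rfl⟩ | ⟨h, rfl⟩)
  · exact (hp.ne_parent h).symm
  · exact hp.ne_parent h

lemma IsRooted.arcGraph_connected (hp : IsRooted p) : (arcGraph p).Connected := by
  rw [SimpleGraph.connected_iff_exists_forall_reachable]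
  refine ⟨0, fun u => ?_⟩
  induction u using hp.induction with
  | h0 => exact .refl _
  | h u hu ih => exact ih.trans (SimpleGraph.Adj.reachable (hp.arcGraph_adj.2 (.inr ⟨hu, rfl⟩)))

lemma IsRooted.arcGraph_isTree (hp : IsRooted p) : (arcGraph p).IsTree := by
  rw [SimpleGraph.isTree_iff_connected_and_card]
  refine ⟨hp.arcGraph_connected,
    le_antisymm ?_ hp.arcGraph_connected.card_vert_le_card_edgeSet_add_one⟩
  -- every edge is `s(u, p u)` for a nonzero `u`
  have hsub : (arcGraph p).edgeSet ⊆ Set.range (fun i : Fin n => s(i.succ, p i.succ)) := by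
    intro e
    induction e using Sym2.ind with
    | _ a b =>
      rw [SimpleGraph.mem_edgeSet, hp.arcGraph_adj]
      rintro (⟨h, rfl⟩ | ⟨h, rfl⟩)
      · obtain ⟨i, rfl⟩ := Fin.exists_succ_eq.2 h
        exact ⟨i, rfl⟩
      · obtain ⟨i, rfl⟩ := Fin.exists_succ_eq.2 h
        exact ⟨i, Sym2.eq_swap⟩
  have h1 := Set.ncard_le_ncard hsub
  rw [← _root_.Nat.card_coe_set_eq] at h1
  have h2 : (Set.range (fun i : Fin n => s(i.succ, p i.succ))).ncard ≤ n := by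
    rw [← Set.image_univ]
    refine (Set.ncard_image_le Set.finite_univ).trans ?_
    simp [Set.ncard_univ]
  simp only [Nat.card_eq_fintype_card, Fintype.card_fin] at *
  omega

lemma exists_closer {V : Type} {T : SimpleGraph V} (hT : T.Connected) (r u : V) (hu : u ≠ r) :
    ∃ v, T.Adj u v ∧ T.dist v r < T.dist u r := by
  obtain ⟨w, hw⟩ := hT.exists_walk_length_eq_dist u r
  cases w with
  | nil => exact absurd rfl hu
  | cons h w' =>
    refine ⟨_, h, ?_⟩
    have := SimpleGraph.dist_le w'
    rw [SimpleGraph.Walk.length_cons] at hw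
    omega

/-- In the graph of a parent map, the parent is the only neighbour closer to `0`. -/
lemma IsRooted.eq_parent_of_closer (hp : IsRooted p) {u v : Fin (n + 1)}
    (h : (arcGraph p).Adj u v) (hd : (arcGraph p).dist v 0 < (arcGraph p).dist u 0) :
    u ≠ 0 ∧ v = p u := by
  induction hk : (arcGraph p).dist u 0 using Nat.strong_induction_on generalizing u v with
  | _ k ih =>
    rcases hp.arcGraph_adj.1 h with h1 | ⟨hv, h1⟩
    · exact h1
    · -- otherwise `u` is the parent of `v`, and a neighbour of `v` closer to `0` must be `u`
      exfalso
      obtain ⟨x, hvx, hx⟩ := exists_closer hp.arcGraph_connected 0 v hv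
      have := (ih _ (hk ▸ hd) hvx hx rfl).2
      rw [← h1] at this
      subst this
      omega

lemma IsRooted.arcsToRoot_arcGraph (hp : IsRooted p) : arcsToRoot (arcGraph p) = arcsOf p := by
  ext ⟨u, v⟩
  simp only [arcsToRoot, Finset.mem_filter, Finset.mem_univ, true_and, mem_arcsOf]
  refine ⟨fun h => hp.eq_parent_of_closer h.1 h.2, fun ⟨hu, hv⟩ => ?_⟩
  obtain ⟨x, hx, hd⟩ := exists_closer hp.arcGraph_connected 0 u hu
  have := (hp.eq_parent_of_closer hx hd).2
  rw [hv, ← this]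
  exact ⟨hx, hd⟩

lemma exists_isRooted_arcGraph_eq {T : SimpleGraph (Fin (n + 1))} (hT : T.IsTree) :
    ∃ p : Fin (n + 1) → Fin (n + 1), IsRooted p ∧ T = arcGraph p := by
  choose! p hadj hdist using exists_closer hT.connected 0
  have hp : IsRooted p :=
    Subrelation.wf (r := fun b a => T.dist b 0 < T.dist a 0)
      (fun {b a} h => by
        rw [mem_arcsOf] at h
        rw [h.2]
        exact hdist a h.1)
      (measure (fun a => T.dist a 0)).wf
  have hle : arcGraph p ≤ T := by
    intro a b h
    rcases hp.arcGraph_adj.1 h with ⟨h', rfl⟩ | ⟨h', rfl⟩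
    · exact hadj _ h'
    · exact (hadj _ h').symm
  exact ⟨p, hp, le_antisymm
    ((SimpleGraph.isTree_iff_minimal_connected.1 hT).2 hp.arcGraph_connected hle) hle⟩

lemma extendedGraph_adj {G : SimpleGraph (Fin n)} {u v : Fin (n + 1)} (hu : u ≠ 0) :
    (extendedGraph G).Adj u v ↔ v = 0 ∨ (G.map (Fin.succEmb n)).Adj u v := by
  simp only [extendedGraph, SimpleGraph.sup_adj, SimpleGraph.fromRel_adj]
  by_cases hv : v = 0
  · simp [hv, hu]
  · simp [hv, hu]

/-- Rooted trees are given by parent maps all of whose arcs go to `0` or along edges of `G`. -/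
lemma isRootedTree_iff {G : SimpleGraph (Fin n)} {D : Arcs n} :
    IsRootedTree G D ↔ ∃ p : Fin (n + 1) → Fin (n + 1), IsRooted p ∧ D = arcsOf p ∧
      ∀ u, u ≠ 0 → p u = 0 ∨ (G.map (Fin.succEmb n)).Adj u (p u) := by
  constructor
  · rintro ⟨T, hT, hle, rfl⟩
    obtain ⟨p, hp, rfl⟩ := exists_isRooted_arcGraph_eq hT
    exact ⟨p, hp, hp.arcsToRoot_arcGraph, fun u hu =>
      (extendedGraph_adj hu).1 (hle (hp.arcGraph_adj.2 (.inl ⟨hu, rfl⟩)))⟩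
  · rintro ⟨p, hp, rfl, h⟩
    refine ⟨arcGraph p, hp.arcGraph_isTree, fun a b hab => ?_, hp.arcsToRoot_arcGraph.symm⟩
    rcases hp.arcGraph_adj.1 hab with ⟨ha, rfl⟩ | ⟨hb, rfl⟩
    · exact (extendedGraph_adj ha).2 (h a ha)
    · exact ((extendedGraph_adj hb).2 (h b hb)).symm

lemma isRootedTree_top_arcsOf (hp : IsRooted p) :
    IsRootedTree (⊤ : SimpleGraph (Fin n)) (arcsOf p) := by
  refine isRootedTree_iff.2 ⟨p, hp, rfl, fun u hu => or_iff_not_imp_left.2 fun h => ?_⟩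
  obtain ⟨i, hi⟩ := Fin.exists_succ_eq.2 hu
  obtain ⟨j, hj⟩ := Fin.exists_succ_eq.2 h
  rw [SimpleGraph.map_adj]
  refine ⟨i, j, ?_, by simpa using hi, by simpa using hj⟩
  rintro rfl
  exact hp.ne_parent hu (hj.symm.trans hi)

/-- The roots of the forest with parent map `p`. -/
def rootsOf (p : Fin (n + 1) → Fin (n + 1)) : Finset (Fin (n + 1)) :=
  Finset.univ.filter (fun u => u ≠ 0 ∧ p u = 0)

@[simp] lemma mem_rootsOf {u : Fin (n + 1)} : u ∈ rootsOf p ↔ u ≠ 0 ∧ p u = 0 := by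
  simp [rootsOf]

lemma IsRooted.exists_root (hp : IsRooted p) (u : Fin (n + 1)) (hu : u ≠ 0) :
    ∃ r ∈ rootsOf p, Relation.ReflTransGen (fun a b => (a, b) ∈ arcsOf p) u r := by
  revert hu
  induction u using hp.induction with
  | h0 => exact fun h => absurd rfl h
  | h u hu ih =>
    intro _
    by_cases h : p u = 0
    · exact ⟨u, by simp [hu, h], .refl⟩
    · obtain ⟨r, hr, h'⟩ := ih h
      exact ⟨r, hr, .head (by simp [hu]) h'⟩

/-- Each component of the forest contains exactly one root. -/
lemma IsRooted.card_components (hp : IsRooted p) :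
    Nat.card (forest (arcsOf p)).ConnectedComponent = (rootsOf p).card := by
  -- `ρ u` is the root of the tree of `u`; it is constant on components
  choose! ρ hρ hreach using hp.exists_root
  have hρ' : ∀ u, u ≠ 0 → ρ u ≠ 0 ∧ p (ρ u) = 0 := fun u hu => mem_rootsOf.1 (hρ u hu)
  have hadj : ∀ i j : Fin n, (i.succ, j.succ) ∈ arcsOf p → ρ i.succ = ρ j.succ := by
    intro i j h
    have hi := hρ' _ (Fin.succ_ne_zero i)
    have hj := hρ' _ (Fin.succ_ne_zero j)
    exact root_unique hi.1 hj.1 hi.2 hj.2 (hreach _ (Fin.succ_ne_zero i))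
      (.head h (hreach _ (Fin.succ_ne_zero j)))
  have hreachable : ∀ i j : Fin n, (forest (arcsOf p)).Reachable i j → ρ i.succ = ρ j.succ := by
    rintro i j ⟨w⟩
    induction w with
    | nil => rfl
    | cons h _ ih =>
      rw [forest, SimpleGraph.fromRel_adj] at h
      rcases h.2 with h | h
      · exact (hadj _ _ h).trans ih
      · exact (hadj _ _ h).symm.trans ih
  have hroot : ∀ r ∈ rootsOf p, ρ r = r := by
    intro r hr
    rw [mem_rootsOf] at hr
    exact root_unique (hρ' r hr.1).1 hr.1 (hρ' r hr.1).2 hr.2 (hreach r hr.1) .refl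
  -- every vertex is connected to its root in the forest
  have hcomp : ∀ u : Fin (n + 1), ∀ hu : u ≠ 0, ∃ i j : Fin n, i.succ = u ∧ j.succ = ρ u ∧
      (forest (arcsOf p)).Reachable i j := by
    intro u
    induction u using hp.induction with
    | h0 => exact fun h => absurd rfl h
    | h u hu ih =>
      intro _
      obtain ⟨i, rfl⟩ := Fin.exists_succ_eq.2 hu
      by_cases h : p i.succ = 0
      · exact ⟨i, i, rfl, (hroot _ (by simp [h])).symm, .refl _⟩
      · obtain ⟨k, j, hk, hj, hkj⟩ := ih h
        have hik : (i.succ, k.succ) ∈ arcsOf p := by simp [hk]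
        refine ⟨i, j, rfl, ?_, .trans (SimpleGraph.Adj.reachable ?_) hkj⟩
        · rw [hj, ← hk, hadj i k hik]
        · rw [forest, SimpleGraph.fromRel_adj]
          refine ⟨?_, .inl hik⟩
          rintro rfl
          exact hp.ne_parent hu hk.symm
  rw [← Nat.card_eq_finsetCard]
  refine Nat.card_congr (Equiv.ofBijective
    (SimpleGraph.ConnectedComponent.lift
      (fun i : Fin n => (⟨ρ i.succ, hρ _ (Fin.succ_ne_zero i)⟩ : rootsOf p))
      (fun i j w _ => Subtype.ext (hreachable i j ⟨w⟩))) ⟨?_, ?_⟩)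
  · intro c d
    induction c using SimpleGraph.ConnectedComponent.ind with | _ i =>
    induction d using SimpleGraph.ConnectedComponent.ind with | _ j =>
    intro h
    have h : ρ i.succ = ρ j.succ := by simpa using h
    obtain ⟨i', k, hi, hk, hik⟩ := hcomp _ (Fin.succ_ne_zero i)
    obtain ⟨j', l, hj, hl, hjl⟩ := hcomp _ (Fin.succ_ne_zero j)
    rw [Fin.succ_inj] at hi hj
    have hkl : k = l := Fin.succ_injective _ (by rw [hk, hl, h])
    subst hi hj hkl
    exact SimpleGraph.ConnectedComponent.sound (hik.trans hjl.symm)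
  · rintro ⟨r, hr⟩
    have hr0 : r ≠ 0 := (mem_rootsOf.1 hr).1
    obtain ⟨i, rfl⟩ := Fin.exists_succ_eq.2 hr0
    exact ⟨(forest (arcsOf p)).connectedComponentMk i, Subtype.ext (hroot _ hr)⟩

/-! ### Cutting off the subtrees of a set of vertices -/

/-- The parent map obtained from `p` by making every vertex of `S` a root. -/
def cut (p : Fin (n + 1) → Fin (n + 1)) (S : Finset (Fin (n + 1))) :
    Fin (n + 1) → Fin (n + 1) :=
  fun u => if u ∈ S then 0 else p u

lemma cut_of_mem {S : Finset (Fin (n + 1))} {u : Fin (n + 1)} (h : u ∈ S) : cut p S u = 0 :=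
  if_pos h

lemma cut_of_notMem {S : Finset (Fin (n + 1))} {u : Fin (n + 1)} (h : u ∉ S) :
    cut p S u = p u :=
  if_neg h

lemma IsRooted.cut (hp : IsRooted p) (S : Finset (Fin (n + 1))) : IsRooted (cut p S) := by
  refine ⟨fun u => ?_⟩
  induction u using WellFounded.induction hp with
  | _ u ih =>
    refine ⟨_, fun y hy => ?_⟩
    rw [mem_arcsOf] at hy
    by_cases hu : u ∈ S
    · rw [hy.2, cut_of_mem hu]
      exact acc_zero _
    · rw [cut_of_notMem hu] at hy
      exact ih y (mem_arcsOf.2 hy)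

lemma cut_eq_self {S : Finset (Fin (n + 1))} (h : ∀ r ∈ S, p r = 0) : cut p S = p := by
  funext u
  by_cases hu : u ∈ S
  · rw [cut_of_mem hu, h u hu]
  · exact cut_of_notMem hu

lemma cut_erase {S : Finset (Fin (n + 1))} {u : Fin (n + 1)} :
    cut p (S.erase u) = Function.update (cut p S) u (p u) := by
  funext v
  by_cases hv : v = u
  · subst hv; simp [cut]
  · simp [cut, hv]

lemma cut_insert {S : Finset (Fin (n + 1))} {u : Fin (n + 1)} :
    cut p (insert u S) = Function.update (cut p S) u 0 := by
  funext v
  by_cases hv : v = u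
  · subst hv; simp [cut]
  · simp [cut, hv]

/-- Redirecting the arc of `u` to `w`. -/
lemma insert_erase_arcsOf {u w x : Fin (n + 1)} (hu : u ≠ 0) (hx : p u = x) :
    insert (u, w) ((arcsOf p).erase (u, x)) = arcsOf (Function.update p u w) := by
  ext ⟨a, b⟩
  by_cases h : a = u
  · subst h
    simp only [Finset.mem_insert, Finset.mem_erase, mem_arcsOf, hx, Function.update_self,
      Prod.mk.injEq, true_and, ne_eq]
    tauto
  · simp [h]

/-- Attaching the subtree of a root `u` to a vertex outside this subtree creates no cycle. -/
lemma IsRooted.update (hq : IsRooted q) {u w : Fin (n + 1)} (hwu : w ≠ u)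
    (hw : ¬ IsChild (arcsOf q) w u) : IsRooted (Function.update q u w) := by
  have key : ∀ x, x ≠ u → ¬ IsChild (arcsOf q) x u →
      Acc (fun b a => (a, b) ∈ arcsOf (Function.update q u w)) x := by
    intro x
    induction x using WellFounded.induction hq with
    | _ x ih =>
      intro hx hxu
      refine ⟨_, fun y hy => ?_⟩
      rw [mem_arcsOf, Function.update_of_ne hx, ← mem_arcsOf (p := q)] at hy
      refine ih y hy ?_ fun h => hxu (.head hy h)
      rintro rfl
      exact hxu (.single hy)
  refine ⟨fun x => ?_⟩
  induction x using WellFounded.induction hq with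
  | _ x ih =>
    refine ⟨_, fun y hy => ?_⟩
    by_cases hx : x = u
    · rw [mem_arcsOf, hx, Function.update_self] at hy
      rw [hy.2]
      exact key w hwu hw
    · rw [mem_arcsOf, Function.update_of_ne hx, ← mem_arcsOf (p := q)] at hy
      exact ih y hy

/-- Paths to a nonzero vertex avoid `0`, hence use no arc of the vertices that have been cut off. -/
lemma IsChild.of_cut {S : Finset (Fin (n + 1))} {x y : Fin (n + 1)} (hy : y ≠ 0)
    (h : IsChild (arcsOf (cut p S)) x y) : IsChild (arcsOf p) x y := by
  have arc : ∀ a b, b ≠ 0 → (a, b) ∈ arcsOf (cut p S) → (a, b) ∈ arcsOf p := by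
    intro a b hb h
    rw [mem_arcsOf] at h ⊢
    by_cases ha : a ∈ S
    · exact absurd (h.2.trans (cut_of_mem ha)) hb
    · rwa [cut_of_notMem ha] at h
  induction h using Relation.TransGen.head_induction_on with
  | single h => exact .single (arc _ _ hy h)
  | head h h' ih =>
    refine .head (arc _ _ ?_ h) ih
    rintro rfl
    exact not_isChild_zero _ h'

/-! ### The common recursion of the two algorithms -/

/-- The vertices of `S` that have no other vertex of `S` in their subtree. -/
def minimalVertices (p : Fin (n + 1) → Fin (n + 1)) (S : Finset (Fin (n + 1))) :
    Set (Fin (n + 1)) :=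
  {y | y ∈ S ∧ ∀ x ∈ S, ¬ IsChild (arcsOf p) x y}

/-- `W` is the code of `S` in the tree with parent map `p`: as long as `S` has more than one
element, the largest minimal vertex of `S` is deleted and its parent is written down; the
last vertex has to be a root. Neither pruning nor cutting appears here, so that the tree stays
the same during the recursion. -/
inductive Code (p : Fin (n + 1) → Fin (n + 1)) : Finset (Fin (n + 1)) → List (Fin (n + 1)) → Prop
  | nil (S : Finset (Fin (n + 1))) (hS : S.card ≤ 1) (hroot : ∀ r ∈ S, p r = 0) : Code p S []
  | cons (S : Finset (Fin (n + 1))) (u : Fin (n + 1)) (W : List (Fin (n + 1)))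
      (hS : 1 < S.card) (hu : IsGreatest (minimalVertices p S) u)
      (h : Code p (S.erase u) W) : Code p S (p u :: W)

lemma Code.length_eq {S : Finset (Fin (n + 1))} {W : List (Fin (n + 1))} (h : Code p S W) :
    W.length = S.card - 1 := by
  induction h with
  | nil S hS _ => simp; omega
  | cons S u W hS hu _ ih =>
    rw [List.length_cons, ih, Finset.card_erase_of_mem hu.1.1]
    omega

lemma Code.exists_of_mem {S : Finset (Fin (n + 1))} {W : List (Fin (n + 1))} (h : Code p S W) :
    ∀ w ∈ W, ∃ x ∈ S, p x = w := by
  induction h with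
  | nil => simp
  | cons S u W hS hu _ ih =>
    intro w hw
    rcases List.mem_cons.1 hw with rfl | hw
    · exact ⟨u, hu.1.1, rfl⟩
    · obtain ⟨x, hx, h⟩ := ih w hw
      exact ⟨x, Finset.mem_of_mem_erase hx, h⟩

lemma Code.parent_mem {S : Finset (Fin (n + 1))} {W : List (Fin (n + 1))} (h : Code p S W) :
    ∀ x ∈ S, p x ≠ 0 → p x ∈ W := by
  induction h with
  | nil S hS hroot => exact fun x hx h => absurd (hroot x hx) h
  | cons S u W hS hu _ ih =>
    intro x hx h
    by_cases hxu : x = u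
    · simp [hxu]
    · exact List.mem_cons_of_mem _ (ih x (Finset.mem_erase.2 ⟨hxu, hx⟩) h)

lemma exists_isGreatest_of_nonempty {s : Set (Fin (n + 1))} (hs : s.Nonempty) :
    ∃ u, IsGreatest s u := by
  obtain ⟨u, hu, h⟩ := Set.exists_max_image s id (Set.toFinite s) hs
  exact ⟨u, hu, h⟩

lemma exists_minimalVertex (hp : IsRooted p) {S : Finset (Fin (n + 1))} (hS : S.Nonempty) :
    ∃ u, IsGreatest (minimalVertices p S) u := by
  obtain ⟨u, hu, hmin⟩ := hp.wellFounded_isChild.has_min (S : Set (Fin (n + 1))) hS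
  have hne : (minimalVertices p S).Nonempty := ⟨u, hu, fun x hx => hmin x hx⟩
  exact exists_isGreatest_of_nonempty hne

/-- A set that contains with each vertex the root of its tree has a code: this property
survives the deletion of a minimal vertex, and it makes the last vertex a root. -/
lemma exists_code (hp : IsRooted p) (S : Finset (Fin (n + 1))) (h0 : 0 ∉ S)
    (hS : ∀ x ∈ S, ∃ r ∈ S, p r = 0 ∧
      Relation.ReflTransGen (fun a b => (a, b) ∈ arcsOf p) x r) : ∃ W, Code p S W := by
  induction hk : S.card generalizing S with
  | zero =>
    rw [Finset.card_eq_zero] at hk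
    exact ⟨[], .nil S (by simp [hk]) (by simp [hk])⟩
  | succ k ih =>
    by_cases hc : 1 < S.card
    · obtain ⟨u, hu⟩ := exists_minimalVertex hp (Finset.card_pos.1 (by omega : 0 < S.card))
      obtain ⟨W, hW⟩ := ih (S.erase u) (fun h => h0 (Finset.mem_of_mem_erase h)) (by
        intro x hx
        obtain ⟨r, hr, hpr, hxr⟩ := hS x (Finset.mem_of_mem_erase hx)
        refine ⟨r, Finset.mem_erase.2 ⟨?_, hr⟩, hpr, hxr⟩
        rintro rfl
        rcases Relation.reflTransGen_iff_eq_or_transGen.1 hxr with h | h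
        · exact (Finset.ne_of_mem_erase hx) h.symm
        · exact hu.1.2 x (Finset.mem_of_mem_erase hx) h) (by
          rw [Finset.card_erase_of_mem hu.1.1]; omega)
      exact ⟨_, .cons S u W hc hu hW⟩
    · refine ⟨[], .nil S (by omega) fun x hx => ?_⟩
      obtain ⟨r, hr, hpr, -⟩ := hS x hx
      rwa [Finset.card_le_one.1 (by omega) x hx r hr]

/-- The candidates considered by `ψ` are the minimal vertices: the last vertex of `S` on a path
from `S` to `y` has its parent in `W`, and from there on the path survives the cutting. -/
lemma minimalVertices_eq (S : Finset (Fin (n + 1))) (h0 : 0 ∉ S)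
    {W : List (Fin (n + 1))} (h1 : ∀ w ∈ W, ∃ x ∈ S, p x = w)
    (h2 : ∀ x ∈ S, p x ≠ 0 → p x ∈ W) :
    {y | y ∈ S ∧ ∀ w ∈ W, w ≠ y ∧ ¬ IsChild (arcsOf (cut p S)) w y} = minimalVertices p S := by
  ext y
  refine and_congr_right fun hy => ?_
  have hy0 : y ≠ 0 := fun h => h0 (h ▸ hy)
  have hS0 : ∀ x ∈ S, x ≠ 0 := fun x hx h => h0 (h ▸ hx)
  constructor
  · intro h x hx hxy
    -- from a vertex outside `S`, the path to `y` avoids `S` before `y`, so it survives the cutting;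
    -- from a vertex in `S`, its second vertex would be a forbidden entry of `W`
    have key : (x ∈ S → False) ∧ (x ∉ S → IsChild (arcsOf (cut p S)) x y) := by
      clear hx
      induction hxy using Relation.TransGen.head_induction_on with
      | @single a hab =>
        rw [mem_arcsOf] at hab
        refine ⟨fun ha => ?_, fun ha => .single ?_⟩
        · exact (h y (hab.2 ▸ h2 a ha (hab.2 ▸ hy0))).1 rfl
        · rw [mem_arcsOf, cut_of_notMem ha]
          exact hab
      | @head a b hab hby ih =>
        have hb0 : b ≠ 0 := by
          rintro rfl
          exact not_isChild_zero _ hby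
        rw [mem_arcsOf] at hab
        have hb : b ∉ S := fun hb => ih.1 hb
        refine ⟨fun ha => ?_, fun ha => .head ?_ (ih.2 hb)⟩
        · exact (h b (hab.2 ▸ h2 a ha (hab.2 ▸ hb0))).2 (ih.2 hb)
        · rw [mem_arcsOf, cut_of_notMem ha]
          exact hab
    exact key.1 hx
  · intro h w hw
    obtain ⟨x, hx, rfl⟩ := h1 w hw
    have hx' : (x, p x) ∈ arcsOf p := by simp [hS0 x hx]
    refine ⟨fun hxy => h x hx (.single (hxy ▸ hx')), fun hc => h x hx (.head hx' ?_)⟩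
    exact IsChild.of_cut hy0 hc

/-- Each entry of `W` lies in the subtree of at most one element of `R`, so that some element
of `R` can be chosen by `ψ`. -/
lemma exists_free_root {R : Finset (Fin (n + 1))} (hR : R ⊆ rootsOf q)
    {W : List (Fin (n + 1))} (hc : W.length < R.card) :
    ∃ u, IsGreatest {y | y ∈ R ∧ ∀ x ∈ W, x ≠ y ∧ ¬ IsChild (arcsOf q) x y} u := by
  have hne : {y | y ∈ R ∧ ∀ x ∈ W, x ≠ y ∧ ¬ IsChild (arcsOf q) x y}.Nonempty := by
    by_contra hne
    have h : ∀ y ∈ R, ∃ x ∈ W, Relation.ReflTransGen (fun a b => (a, b) ∈ arcsOf q) x y := by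
      intro y hy
      by_contra! h
      exact hne ⟨y, hy, fun x hx =>
        ⟨fun e => h x hx (e ▸ .refl), fun e => h x hx (Relation.TransGen.to_reflTransGen e)⟩⟩
    choose! f hf hreach using h
    have hle : R.card ≤ W.toFinset.card := by
      refine Finset.card_le_card_of_injOn f (fun y hy => by simpa using hf y hy) ?_
      intro y hy z hz hyz
      have hy' := mem_rootsOf.1 (hR hy)
      have hz' := mem_rootsOf.1 (hR hz)
      exact root_unique hy'.1 hz'.1 hy'.2 hz'.2 (hreach y hy) (hyz ▸ hreach z hz)
    have := W.toFinset_card_le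
    omega
  exact exists_isGreatest_of_nonempty hne

/-- Every word of the right length is a code for every prescribed forest with root set `R`. -/
lemma exists_cut_eq_code (hq : IsRooted q) {R : Finset (Fin (n + 1))} (hR : R ⊆ rootsOf q)
    {W : List (Fin (n + 1))} (hW : W.length = R.card - 1) :
    ∃ p, IsRooted p ∧ cut p R = q ∧ Code p R W := by
  induction W generalizing q R with
  | nil =>
    have h : ∀ r ∈ R, q r = 0 := fun r hr => (mem_rootsOf.1 (hR hr)).2
    exact ⟨q, hq, cut_eq_self h, .nil R (by simp at hW; omega) h⟩
  | cons w W ih =>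
    rw [List.length_cons] at hW
    obtain ⟨u, hu⟩ := exists_free_root hR (W := w :: W) (by rw [List.length_cons]; omega)
    have hw := hu.1.2 w (by simp)
    have hcard := Finset.card_erase_of_mem hu.1.1
    -- attach `u` to `w` and decode the rest of the word
    obtain ⟨p, hp, hcut, hcode⟩ := ih (hq.update hw.1 hw.2) (R := R.erase u) (by
      intro r hr
      rw [Finset.mem_erase] at hr
      simpa [hr.1] using hR hr.2) (by omega)
    have hpu : p u = w := by
      rw [← cut_of_notMem (p := p) (Finset.notMem_erase u R), hcut, Function.update_self]
    have hcut' : cut p R = q := by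
      rw [← Finset.insert_erase hu.1.1, cut_insert, hcut, Function.update_idem,
        ← (mem_rootsOf.1 (hR hu.1.1)).2, Function.update_eq_self]
    refine ⟨p, hp, hcut', ?_⟩
    subst hpu
    refine .cons R u W (by omega) ?_ hcode
    rw [← minimalVertices_eq R (fun h => (mem_rootsOf.1 (hR h)).1 rfl) (W := p u :: W), hcut']
    · exact hu
    · intro x hx
      rcases List.mem_cons.1 hx with rfl | hx
      · exact ⟨u, hu.1.1, rfl⟩
      · obtain ⟨y, hy, h⟩ := hcode.exists_of_mem x hx
        exact ⟨y, Finset.mem_of_mem_erase hy, h⟩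
    · intro x hx h
      by_cases hxu : x = u
      · simp [hxu]
      · exact List.mem_cons_of_mem _ (hcode.parent_mem x (Finset.mem_erase.2 ⟨hxu, hx⟩) h)

/-! ### Executions of nondeterministic programs -/

lemma Acc.exists_terminal {σ : Type} {step : σ → σ → Prop} {s : σ}
    (h : Acc (fun t' t => step t t') s) :
    ∃ t, Relation.ReflTransGen step s t ∧ ∀ t', ¬ step t t' := by
  induction h with
  | intro s _ ih =>
    by_cases hs : ∃ t, step s t
    · obtain ⟨t, ht⟩ := hs
      obtain ⟨t', h, h'⟩ := ih t ht
      exact ⟨t', .head ht h, h'⟩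
    · exact ⟨s, .refl, fun t ht => hs ⟨t, ht⟩⟩

lemma Computes.unique {σ β : Type} {step : σ → σ → Prop} {final : σ → Prop} {out : σ → β}
    {s : σ} {b b' : β} (h : Computes step final out s b) (h' : Computes step final out s b') :
    b = b' := by
  obtain ⟨t, ht, hterm⟩ := Acc.exists_terminal h.1
  exact (h.2 t ht hterm).2.symm.trans (h'.2 t ht hterm).2

/-- A program computes `b` if it has an invariant that yields the output `b` at every state without
successor, and a measure that decreases along the states satisfying the invariant. -/
lemma computes_of_invariant {σ β : Type} {step : σ → σ → Prop} {final : σ → Prop} {out : σ → β}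
    (Inv : σ → Prop) (μ : σ → ℕ) {s : σ} {b : β} (h0 : Inv s)
    (hstep : ∀ t t', Inv t → step t t' → Inv t' ∧ μ t' < μ t)
    (hend : ∀ t, Inv t → (∀ t', ¬ step t t') → final t ∧ out t = b) :
    Computes step final out s b := by
  refine ⟨?_, fun t ht hterm => hend t ?_ hterm⟩
  · induction hk : μ s using Nat.strong_induction_on generalizing s with
    | _ k ih =>
      refine ⟨_, fun t ht => ?_⟩
      have := hstep s t h0 ht
      exact ih _ (hk ▸ this.2) this.1 rfl
  · clear hterm
    induction ht with
    | refl => exact h0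
    | tail _ h ih => exact (hstep _ _ ih h).1

/-! ### The algorithm `ψ` decodes -/

/-- The pairs `(u, p u)` with `u ∈ S` that do not point to `0`. -/
def operationalPairs (p : Fin (n + 1) → Fin (n + 1)) (S : Finset (Fin (n + 1))) : Arcs n :=
  (arcsOf p).filter (fun e => e.1 ∈ S ∧ e.2 ≠ 0)

lemma mem_operationalPairs {S : Finset (Fin (n + 1))} {a b : Fin (n + 1)} :
    (a, b) ∈ operationalPairs p S ↔ (a ≠ 0 ∧ b = p a) ∧ a ∈ S ∧ b ≠ 0 := by
  simp [operationalPairs]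

lemma mem_image_fst_filter_arcsOf (P : Fin (n + 1) × Fin (n + 1) → Prop)
    [DecidablePred P] {u : Fin (n + 1)} :
    u ∈ ((arcsOf p).filter P).image Prod.fst ↔ u ≠ 0 ∧ P (u, p u) := by
  simp only [Finset.mem_image, Finset.mem_filter, Prod.exists, mem_arcsOf]
  constructor
  · rintro ⟨a, b, ⟨⟨ha, rfl⟩, hP⟩, rfl⟩
    exact ⟨ha, hP⟩
  · rintro ⟨hu, hP⟩
    exact ⟨u, p u, ⟨⟨hu, rfl⟩, hP⟩, rfl⟩

/-- If `W` is a code of `S`, then `ψ` recovers the tree from the forest and `W`, because at every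
stage its forest is the tree cut at the remaining roots. -/
lemma Code.psiComputes {S : Finset (Fin (n + 1))} {W : List (Fin (n + 1))}
    (h : Code p S W) (h0 : 0 ∉ S) (hS : S = rootsOf (cut p S)) :
    PsiComputes (arcsOf (cut p S), W) (arcsOf p, operationalPairs p S) := by
  refine computes_of_invariant
    (fun s => s.F = arcsOf (cut p s.R) ∧ Code p s.R s.W ∧ 0 ∉ s.R ∧
      s.O ∪ operationalPairs p s.R = operationalPairs p S)
    (fun s => s.W.length) ?_ ?_ ?_
  · have hR : (psiInit (arcsOf (cut p S), W)).R = S := by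
      ext u
      rw [psiInit, mem_image_fst_filter_arcsOf]
      conv_rhs => rw [hS, mem_rootsOf]
    rw [hR]
    exact ⟨rfl, h, h0, by simp [psiInit]⟩
  · rintro s _ ⟨hF, hcode, h0, hO⟩ ⟨w, W', u, hW, hu⟩
    simp only at *
    rw [hF, minimalVertices_eq s.R h0 hcode.exists_of_mem hcode.parent_mem] at hu
    have hu0 : u ≠ 0 := fun h => h0 (h ▸ hu.1.1)
    rw [hW] at hcode
    cases hcode with
    | cons _ u' _ hS hu' hcode =>
      obtain rfl := hu.unique hu'
      refine ⟨⟨?_, hcode, fun h => h0 (Finset.mem_of_mem_erase h), ?_⟩, by simp [hW]⟩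
      · rw [hF, insert_erase_arcsOf hu0 (cut_of_mem hu.1.1), cut_erase]
      · rw [← hO]
        ext ⟨a, b⟩
        have hum := hu.1.1
        by_cases ha : a = u
        · subst ha
          split_ifs with hw <;>
            simp only [Finset.mem_union, Finset.mem_insert, mem_operationalPairs,
              Finset.mem_erase, Prod.mk.injEq, true_and, ne_eq, not_true_eq_false, false_and,
              and_false, or_false] <;> grind
        · split_ifs with hw <;> simp [mem_operationalPairs, ha]
  · rintro s ⟨hF, hcode, h0, hO⟩ hterm
    have hW : s.W = [] := by
      by_contra hW
      obtain ⟨w, W', hW⟩ := List.exists_cons_of_ne_nil hW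
      have hset := minimalVertices_eq s.R h0 hcode.exists_of_mem hcode.parent_mem
      rw [← hF] at hset
      rw [hW] at hcode
      cases hcode with
      | cons _ u _ hS hu hcode =>
        rw [← hset] at hu
        exact hterm _ (.attach s _ W' u hW hu)
    refine ⟨hW, ?_⟩
    rw [hW] at hcode
    cases hcode with
    | nil _ hS hroot =>
      have : operationalPairs p s.R = ∅ := by
        ext ⟨a, b⟩
        simp only [mem_operationalPairs, Finset.notMem_empty, iff_false]
        rintro ⟨⟨_, rfl⟩, ha, hb⟩
        exact hb (hroot a ha)
      rw [hF, cut_eq_self hroot, ← hO, this, Finset.union_empty]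

/-! ### The algorithm `φ` encodes -/

/-- The arcs of the vertices in `X`. When `X` is closed under taking parents, this is the subtree
on `X` and `0`. -/
def arcsOn (p : Fin (n + 1) → Fin (n + 1)) (X : Finset (Fin (n + 1))) : Arcs n :=
  (arcsOf p).filter (fun e => e.1 ∈ X)

lemma mem_arcsOn {X : Finset (Fin (n + 1))} {a b : Fin (n + 1)} :
    (a, b) ∈ arcsOn p X ↔ (a ≠ 0 ∧ b = p a) ∧ a ∈ X := by
  simp [arcsOn]

lemma arcsOn_erase {X : Finset (Fin (n + 1))} {u : Fin (n + 1)} :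
    (arcsOn p X).erase (u, p u) = arcsOn p (X.erase u) := by
  ext ⟨a, b⟩
  simp only [Finset.mem_erase, mem_arcsOn, ne_eq, Prod.mk.injEq]
  grind

/-- A set of nonzero vertices that contains the parents of its elements, as far as these are
nonzero. -/
structure IsParentClosed (p : Fin (n + 1) → Fin (n + 1)) (X : Finset (Fin (n + 1))) : Prop where
  zero_notMem : 0 ∉ X
  parent_mem : ∀ x ∈ X, p x ≠ 0 → p x ∈ X

lemma IsParentClosed.ne_zero {X : Finset (Fin (n + 1))} (hX : IsParentClosed p X)
    {x : Fin (n + 1)} (hx : x ∈ X) : x ≠ 0 := fun h => hX.zero_notMem (h ▸ hx)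

lemma IsParentClosed.isLeaf_iff (hp : IsRooted p) {X : Finset (Fin (n + 1))}
    (hX : IsParentClosed p X) {u : Fin (n + 1)} :
    IsLeaf (arcsOn p X) u ↔ u ∈ X ∧ ∀ x ∈ X, p x ≠ u := by
  constructor
  · rintro ⟨hu0, hcard⟩
    obtain ⟨⟨a, b⟩, he⟩ := Finset.card_eq_one.1 hcard
    have hmem : ∀ c d, ((c, d) ∈ arcsOn p X ∧ (c = u ∨ d = u)) → c = a ∧ d = b := by
      intro c d h
      have h' : (c, d) ∈ ({(a, b)} : Arcs n) := by rw [← he, Finset.mem_filter]; exact h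
      simpa using h'
    have hab : (a, b) ∈ arcsOn p X ∧ (a = u ∨ b = u) := by
      have h' : (a, b) ∈ ({(a, b)} : Arcs n) := by simp
      rwa [← he, Finset.mem_filter] at h'
    have huX : u ∈ X := by
      have h1 := mem_arcsOn.1 hab.1
      rcases hab.2 with rfl | rfl
      · exact h1.2
      · exact h1.1.2 ▸ hX.parent_mem a h1.2 (h1.1.2 ▸ hu0)
    refine ⟨huX, fun x hx hxu => ?_⟩
    -- the arc leaving `u` and an arc entering `u` would be two incident arcs
    have h1 := hmem u (p u) ⟨by simp [mem_arcsOn, hu0, huX], .inl rfl⟩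
    have h2 := hmem x u ⟨by simp [mem_arcsOn, hX.ne_zero hx, hx, hxu], .inr rfl⟩
    exact hp.ne_parent hu0 (h1.2.trans h2.2.symm)
  · rintro ⟨hu, h⟩
    refine ⟨hX.ne_zero hu, Finset.card_eq_one.2 ⟨(u, p u), ?_⟩⟩
    ext ⟨a, b⟩
    simp only [Finset.mem_filter, mem_arcsOn, Finset.mem_singleton, Prod.mk.injEq]
    constructor
    · rintro ⟨⟨⟨ha, rfl⟩, haX⟩, rfl | hb⟩
      · exact ⟨rfl, rfl⟩
      · exact absurd hb (h a haX)
    · rintro ⟨rfl, rfl⟩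
      exact ⟨⟨⟨hX.ne_zero hu, rfl⟩, hu⟩, .inl rfl⟩

lemma IsParentClosed.mem_of_reach {X : Finset (Fin (n + 1))} (hX : IsParentClosed p X)
    {x y : Fin (n + 1)} (hx : x ∈ X) (hy : y ≠ 0)
    (h : Relation.ReflTransGen (fun a b => (a, b) ∈ arcsOf p) x y) : y ∈ X := by
  induction h using Relation.ReflTransGen.head_induction_on with
  | refl => exact hx
  | @head a c hac hcy ih =>
    refine ih ?_
    have hc := (mem_arcsOf.1 hac).2
    rw [hc]
    refine hX.parent_mem a hx fun h => ?_
    rw [hc, h] at hcy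
    rcases Relation.reflTransGen_iff_eq_or_transGen.1 hcy with h | h
    · exact hy h
    · exact not_isChild_zero _ h

lemma IsParentClosed.erase {X : Finset (Fin (n + 1))} (hX : IsParentClosed p X)
    {u : Fin (n + 1)} (hu : ∀ x ∈ X, p x ≠ u) : IsParentClosed p (X.erase u) where
  zero_notMem h := hX.zero_notMem (Finset.mem_of_mem_erase h)
  parent_mem x hx h := by
    have hx := Finset.mem_of_mem_erase hx
    exact Finset.mem_erase.2 ⟨hu x hx, hX.parent_mem x hx h⟩

/-- The subtree of every vertex of `X` contains a leaf of `X`. -/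
lemma IsParentClosed.exists_leaf (hp : IsRooted p) {X : Finset (Fin (n + 1))}
    (hX : IsParentClosed p X) (y : Fin (n + 1)) (hy : y ∈ X) :
    ∃ u ∈ X, (∀ x ∈ X, p x ≠ u) ∧ Relation.ReflTransGen (fun a b => (a, b) ∈ arcsOf p) u y := by
  induction y using hp.wellFounded_isChild.induction with
  | _ y ih =>
    by_cases h : ∀ x ∈ X, p x ≠ y
    · exact ⟨y, hy, h, .refl⟩
    · push Not at h
      obtain ⟨x, hx, hxy⟩ := h
      have harc : (x, y) ∈ arcsOf p := by simp [hX.ne_zero hx, hxy]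
      obtain ⟨u, hu, hleaf, hux⟩ := ih x (.single harc) hx
      exact ⟨u, hu, hleaf, .tail hux harc⟩

/-- Once all leaves lie in `S`, they are the minimal vertices of `S`. -/
lemma IsParentClosed.leaves_eq (hp : IsRooted p) {X S : Finset (Fin (n + 1))}
    (hX : IsParentClosed p X) (hSX : S ⊆ X) (hall : ∀ x, IsLeaf (arcsOn p X) x → x ∈ S) :
    {x | IsLeaf (arcsOn p X) x} = minimalVertices p S := by
  ext u
  constructor
  · intro hu
    refine ⟨hall u hu, fun x hx hxu => ?_⟩
    have hu' := (hX.isLeaf_iff hp).1 hu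
    obtain ⟨y, hxy, hyu⟩ := Relation.TransGen.tail'_iff.1 hxu
    rw [mem_arcsOf] at hyu
    exact hu'.2 y (hX.mem_of_reach (hSX hx) hyu.1 hxy) hyu.2.symm
  · rintro ⟨hu, hmin⟩
    refine (hX.isLeaf_iff hp).2 ⟨hSX hu, fun x hx hxu => ?_⟩
    obtain ⟨z, hz, hleaf, hzx⟩ := hX.exists_leaf hp x hx
    have harc : (x, u) ∈ arcsOf p := by simp [hX.ne_zero hx, hxu]
    exact hmin z (hall z ((hX.isLeaf_iff hp).2 ⟨hz, hleaf⟩)) (Relation.TransGen.tail' hzx harc)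

/-- If `W` is a code of `S`, then every execution of `φ` writes down `W`. The invariant is that
the shrinking tree is the subtree on a parent-closed set `X ⊇ S`. -/
lemma Code.phiComputes (hp : IsRooted p) {S : Finset (Fin (n + 1))} {W : List (Fin (n + 1))}
    (h : Code p S W) {O : Arcs n} (hS : (phiInit (arcsOf p, O)).S = S) :
    PhiComputes (arcsOf p, O) (arcsOf (cut p S), W) := by
  have h0 : 0 ∉ S := by
    rw [← hS, phiInit, mem_image_fst_filter_arcsOf]
    simp
  refine computes_of_invariant
    (fun s => (∃ X, IsParentClosed p X ∧ s.S ⊆ X ∧ s.tree = arcsOn p X) ∧ s.S ⊆ S ∧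
      s.F = arcsOf (cut p (S \ s.S)) ∧ ∃ W', Code p s.S W' ∧ s.W ++ W' = W)
    (fun s => s.tree.card) ?_ ?_ ?_
  · rw [hS]
    refine ⟨⟨Finset.univ.erase 0, ⟨by simp, by simp⟩, fun x hx => ?_, ?_⟩, subset_rfl, ?_,
      W, h, rfl⟩
    · simp only [Finset.mem_erase, Finset.mem_univ, and_true]
      rintro rfl
      exact h0 hx
    · ext ⟨a, b⟩
      simp only [phiInit, mem_arcsOf, mem_arcsOn, Finset.mem_erase, Finset.mem_univ]
      tauto
    · rw [Finset.sdiff_self, cut_eq_self (by simp)]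
      rfl
  · rintro s _ ⟨⟨X, hX, hSX, htree⟩, hSS, hF, W', hcode, hW⟩ (⟨u, v, hc, hleaf, hu, huv⟩ |
      ⟨u, v, hc, hall, hu, huv⟩)
    all_goals
      refine ⟨?_, Finset.card_erase_lt_of_mem huv⟩
      rw [htree] at huv
      obtain ⟨⟨hu0, rfl⟩, huX⟩ := mem_arcsOn.1 huv
    · rw [htree, hX.isLeaf_iff hp] at hleaf
      refine ⟨⟨X.erase u, hX.erase hleaf.2, fun x hx => ?_, by rw [htree, arcsOn_erase]⟩,
        hSS, hF, W', hcode, hW⟩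
      exact Finset.mem_erase.2 ⟨fun h => hu (h ▸ hx), hSX hx⟩
    · rw [htree] at hu hall
      have hleaf := (hX.isLeaf_iff hp).1 hu.1
      have huS := hall u hu.1
      rw [hX.leaves_eq hp hSX hall] at hu
      cases hcode with
      | nil _ hS' => omega
      | cons _ u' W'' _ hu' hcode =>
        obtain rfl := hu.unique hu'
        refine ⟨⟨X.erase u, hX.erase hleaf.2, Finset.erase_subset_erase u hSX,
          by rw [htree, arcsOn_erase]⟩, (Finset.erase_subset _ _).trans hSS, ?_, W'', hcode, ?_⟩
        · rw [hF, insert_erase_arcsOf hu0 (cut_of_notMem (by simp [huS])), ← cut_insert,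
            Finset.sdiff_erase (hSS huS)]
        · rw [List.append_assoc]
          exact hW
  · rintro s ⟨⟨X, hX, hSX, htree⟩, hSS, hF, W', hcode, hW⟩ hterm
    have hc : s.S.card ≤ 1 := by
      by_contra! hc
      have hall : ∀ x, IsLeaf s.tree x → x ∈ s.S := by
        intro x hx
        by_contra hxS
        refine hterm _ (.prune s x (p x) hc hx hxS ?_)
        rw [htree] at hx ⊢
        have hxX := ((hX.isLeaf_iff hp).1 hx).1
        exact mem_arcsOn.2 ⟨⟨hX.ne_zero hxX, rfl⟩, hxX⟩
      obtain ⟨u, hu⟩ := exists_minimalVertex hp (Finset.card_pos.1 (by omega : 0 < s.S.card))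
      have huX := hSX hu.1.1
      refine hterm _ (.record s u (p u) hc hall ?_ ?_)
      · rw [htree] at hall ⊢
        rwa [hX.leaves_eq hp hSX hall]
      · rw [htree]
        exact mem_arcsOn.2 ⟨⟨hX.ne_zero huX, rfl⟩, huX⟩
    refine ⟨hc, ?_⟩
    cases hcode with
    | cons _ _ _ hc' => omega
    | nil _ _ hroot =>
      rw [List.append_nil] at hW
      rw [hF, hW]
      congr 2
      funext x
      by_cases hx : x ∈ s.S
      · rw [cut_of_mem (hSS hx), cut_of_notMem (by simp [hx]), hroot x hx]
      · simp [cut, hx]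

/-! ### The bijection -/

lemma mem_forcedPairs {G : SimpleGraph (Fin n)} {D : Arcs n} {e : Fin (n + 1) × Fin (n + 1)} :
    e ∈ forcedPairs G D ↔ e ∈ validPairs D ∧ ¬ (Gᶜ.map (Fin.succEmb n)).Adj e.1 e.2 := by
  classical rw [forcedPairs, Finset.mem_filter]

lemma isOperationalSet_iff {G : SimpleGraph (Fin n)} {D O : Arcs n} :
    IsOperationalSet G D O ↔ forcedPairs G D ⊆ O ∧ O ⊆ validPairs D := by
  have hsub : forcedPairs G D ⊆ validPairs D :=
    fun _ he => (mem_forcedPairs.1 he).1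
  constructor
  · rintro ⟨C, hC, rfl⟩
    exact ⟨Finset.subset_union_right,
      Finset.union_subset (hC.trans Finset.sdiff_subset) hsub⟩
  · rintro ⟨h1, h2⟩
    exact ⟨O \ forcedPairs G D, Finset.sdiff_subset_sdiff h2 subset_rfl,
      (Finset.sdiff_union_of_subset h1).symm⟩

lemma mem_validPairs_arcsOf {a b : Fin (n + 1)} :
    (a, b) ∈ validPairs (arcsOf p) ↔ a ≠ 0 ∧ b = p a ∧ b ≠ 0 := by
  simp only [validPairs, Finset.mem_filter, mem_arcsOf]
  tauto

lemma mem_forcedPairs_arcsOf {G : SimpleGraph (Fin n)} {a b : Fin (n + 1)} :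
    (a, b) ∈ forcedPairs G (arcsOf p) ↔
      (a ≠ 0 ∧ b = p a ∧ b ≠ 0) ∧ ¬ (Gᶜ.map (Fin.succEmb n)).Adj a b := by
  rw [mem_forcedPairs, mem_validPairs_arcsOf]

lemma mem_setB_arcsOf {G : SimpleGraph (Fin n)} (hq : IsRooted q) {W : List (Fin (n + 1))}
    (hG : ∀ u, u ≠ 0 → q u = 0 ∨ (Gᶜ.map (Fin.succEmb n)).Adj u (q u))
    (hW : W.length = (rootsOf q).card - 1) : (arcsOf q, W) ∈ setB G :=
  ⟨isRootedTree_iff.2 ⟨q, hq, rfl, hG⟩, by rw [hW, hq.card_components]⟩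

lemma mem_phiInit_S {O : Arcs n} {u : Fin (n + 1)} :
    u ∈ (phiInit (arcsOf p, O)).S ↔ u ≠ 0 ∧ ((u, p u) ∈ O ∨ p u = 0) := by
  rw [phiInit, mem_image_fst_filter_arcsOf]

lemma exists_encoding {G : SimpleGraph (Fin n)} {a : Arcs n × Arcs n} (ha : a ∈ setA G) :
    ∃ b ∈ setB G, PhiComputes a b ∧ PsiComputes b a := by
  obtain ⟨D, O⟩ := a
  obtain ⟨htree, hO⟩ := ha
  obtain ⟨p, hp, rfl : D = arcsOf p, -⟩ := isRootedTree_iff.1 htree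
  obtain ⟨hforced, hvalid⟩ := isOperationalSet_iff.1 hO
  obtain ⟨S, hS⟩ : ∃ S, (phiInit (arcsOf p, O)).S = S := ⟨_, rfl⟩
  have hmem : ∀ u, u ∈ S ↔ u ≠ 0 ∧ ((u, p u) ∈ O ∨ p u = 0) := fun u => by
    rw [← hS, mem_phiInit_S]
  have h0 : 0 ∉ S := fun h => ((hmem 0).1 h).1 rfl
  obtain ⟨W, hW⟩ := exists_code hp S h0 (by
    intro x hx
    obtain ⟨r, hr, hxr⟩ := hp.exists_root x ((hmem x).1 hx).1
    rw [mem_rootsOf] at hr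
    exact ⟨r, (hmem r).2 ⟨hr.1, .inr hr.2⟩, hr.2, hxr⟩)
  have hroots : S = rootsOf (cut p S) := by
    ext u
    rw [mem_rootsOf]
    by_cases hu : u ∈ S
    · simp [hu, cut_of_mem hu, ((hmem u).1 hu).1]
    · rw [cut_of_notMem hu]
      have := hmem u
      tauto
  have hop : operationalPairs p S = O := by
    ext ⟨a, b⟩
    rw [mem_operationalPairs, hmem]
    constructor
    · rintro ⟨⟨ha, rfl⟩, ⟨-, h | h⟩, hb⟩
      · exact h
      · exact absurd h hb
    · intro h
      obtain ⟨ha, rfl, hb⟩ := mem_validPairs_arcsOf.1 (hvalid h)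
      exact ⟨⟨ha, rfl⟩, ⟨ha, .inl h⟩, hb⟩
  refine ⟨(arcsOf (cut p S), W), mem_setB_arcsOf (hp.cut S) ?_ ?_, hW.phiComputes hp hS, ?_⟩
  · intro u hu0
    by_cases hu : u ∈ S
    · exact .inl (cut_of_mem hu)
    · rw [cut_of_notMem hu]
      by_contra! h
      exact hu ((hmem u).2 ⟨hu0, .inl (hforced (mem_forcedPairs_arcsOf.2 ⟨⟨hu0, rfl, h.1⟩, h.2⟩))⟩)
  · rw [hW.length_eq, ← hroots]
  · have := hW.psiComputes h0 hroots
    rwa [hop] at this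

lemma exists_decoding {G : SimpleGraph (Fin n)} {b : Arcs n × List (Fin (n + 1))}
    (hb : b ∈ setB G) : ∃ a ∈ setA G, PsiComputes b a ∧ PhiComputes a b := by
  obtain ⟨E, W⟩ := b
  obtain ⟨htree, hlen⟩ := hb
  obtain ⟨q, hq, rfl : E = arcsOf q, hG⟩ := isRootedTree_iff.1 htree
  simp only [hq.card_components] at hlen
  obtain ⟨p, hp, hcut, hW⟩ := exists_cut_eq_code hq subset_rfl hlen
  obtain ⟨R, hR⟩ : ∃ R, R = rootsOf q := ⟨_, rfl⟩
  rw [← hR] at hcut hW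
  subst hcut
  have h0 : 0 ∉ R := fun h => (mem_rootsOf.1 (hR ▸ h)).1 rfl
  have hzero : ∀ u, u ≠ 0 → p u = 0 → u ∈ R := by
    intro u hu0 h
    by_contra hu
    refine hu ?_
    rw [hR, mem_rootsOf, cut_of_notMem hu]
    exact ⟨hu0, h⟩
  refine ⟨(arcsOf p, operationalPairs p R), ⟨isRootedTree_top_arcsOf hp,
    isOperationalSet_iff.2 ⟨?_, ?_⟩⟩, hW.psiComputes h0 hR, hW.phiComputes hp ?_⟩
  · rintro ⟨a, b⟩ h
    obtain ⟨⟨ha, rfl, hb⟩, hadj⟩ := mem_forcedPairs_arcsOf.1 h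
    refine mem_operationalPairs.2 ⟨⟨ha, rfl⟩, ?_, hb⟩
    by_contra haR
    have := hG a ha
    rw [cut_of_notMem haR] at this
    tauto
  · rintro ⟨a, b⟩ h
    obtain ⟨⟨ha, hab⟩, -, hb⟩ := mem_operationalPairs.1 h
    exact mem_validPairs_arcsOf.2 ⟨ha, hab, hb⟩
  · ext u
    rw [mem_phiInit_S, mem_operationalPairs]
    constructor
    · rintro ⟨hu, h | h⟩
      · exact h.2.1
      · exact hzero u hu h
    · intro hu
      have hu0 : u ≠ 0 := fun h => h0 (h ▸ hu)
      tauto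

/-! ### The complete graph and the Prüfer code -/

lemma not_adj_map_compl_top (a b : Fin (n + 1)) :
    ¬ ((⊤ : SimpleGraph (Fin n))ᶜ.map (Fin.succEmb n)).Adj a b := by
  rw [SimpleGraph.map_adj]
  rintro ⟨_, _, h, -⟩
  simp at h

lemma forcedPairs_top (D : Arcs n) : forcedPairs (⊤ : SimpleGraph (Fin n)) D = validPairs D := by
  ext e
  rw [mem_forcedPairs]
  exact and_iff_left (not_adj_map_compl_top _ _)

lemma isOperationalSet_top_iff {D O : Arcs n} :
    IsOperationalSet (⊤ : SimpleGraph (Fin n)) D O ↔ O = validPairs D := by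
  rw [isOperationalSet_iff, forcedPairs_top]
  exact ⟨fun h => h.2.antisymm h.1, fun h => by simp [h]⟩

lemma isRooted_const_zero : IsRooted (fun _ : Fin (n + 1) => (0 : Fin (n + 1))) :=
  ⟨fun _ => ⟨_, fun y hy => by
    rw [mem_arcsOf] at hy
    rw [hy.2]
    exact acc_zero _⟩⟩

lemma arcsOf_eq_starArcs (hp : ∀ u, u ≠ 0 → p u = 0) : arcsOf p = starArcs n := by
  ext ⟨a, b⟩
  simp only [mem_arcsOf, starArcs, Finset.mem_filter, Finset.mem_univ, true_and]
  exact and_congr_right fun ha => by rw [hp a ha]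

lemma mem_setB_top_iff {D : Arcs n} {W : List (Fin (n + 1))} :
    (D, W) ∈ setB (⊤ : SimpleGraph (Fin n)) ↔ D = starArcs n ∧ W.length = n - 1 := by
  have hstar := arcsOf_eq_starArcs (n := n) (p := fun _ => 0) (fun _ _ => rfl)
  have hcard : Nat.card (forest (starArcs n)).ConnectedComponent = n := by
    rw [← hstar, isRooted_const_zero.card_components]
    simp [rootsOf, Finset.filter_ne']
  have htree : IsRootedTree (⊤ : SimpleGraph (Fin n))ᶜ D ↔ D = starArcs n := by
    rw [isRootedTree_iff]
    constructor
    · rintro ⟨p, hp, rfl, h⟩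
      exact arcsOf_eq_starArcs fun u hu => (h u hu).resolve_right (not_adj_map_compl_top _ _)
    · rintro rfl
      exact ⟨_, isRooted_const_zero, hstar.symm, fun _ _ => .inl rfl⟩
  change IsRootedTree _ D ∧ _ ↔ _
  rw [htree]
  exact and_congr_right fun h => by rw [h, hcard]

/-- When `S` is parent-closed, its minimal vertices are the nonzero leaves of the tree induced on
`S` and `0`. -/
lemma IsParentClosed.mem_minimalVertices_iff (hp : IsRooted p) {S : Finset (Fin (n + 1))}
    (hS : IsParentClosed p S) {u : Fin (n + 1)} (hu : u ∈ S) :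
    u ∈ minimalVertices p S ↔ ∃! y, y ∈ insert 0 S ∧ (arcGraph p).Adj u y := by
  have hu0 := hS.ne_zero hu
  have hpu : p u ∈ insert 0 S := by
    rw [Finset.mem_insert]
    exact or_iff_not_imp_left.2 (hS.parent_mem u hu)
  have hupu : (arcGraph p).Adj u (p u) := hp.arcGraph_adj.2 (.inl ⟨hu0, rfl⟩)
  constructor
  · rintro ⟨-, hmin⟩
    refine ⟨p u, ⟨hpu, hupu⟩, ?_⟩
    rintro y ⟨hy, hadj⟩
    rcases hp.arcGraph_adj.1 hadj with ⟨-, h⟩ | ⟨hy0, h⟩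
    · exact h
    · exact absurd (.single (mem_arcsOf.2 ⟨hy0, h⟩))
        (hmin y ((Finset.mem_insert.1 hy).resolve_left hy0))
  · intro huniq
    refine ⟨hu, fun x hx hxu => ?_⟩
    obtain ⟨y, hxy, hyu⟩ := Relation.TransGen.tail'_iff.1 hxu
    have hyu' := mem_arcsOf.1 hyu
    have hyS := hS.mem_of_reach hx hyu'.1 hxy
    -- a child `y` of `u` would be a second neighbour, as `y = p u` would give a directed cycle
    have h := huniq.unique ⟨hpu, hupu⟩
      ⟨Finset.mem_insert_of_mem hyS, hp.arcGraph_adj.2 (.inr hyu')⟩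
    exact hp.not_isChild_self u (.head (mem_arcsOf.2 ⟨hu0, h.symm⟩) (.single hyu))

/-- The code of a parent-closed set is a Prüfer code after reversing the order of the labels. As
the root `0` becomes the largest label, it is never the smallest leaf. -/
lemma Code.isPruferCode (hp : IsRooted p) {S : Finset (Fin (n + 1))} {W : List (Fin (n + 1))}
    (h : Code p S W) (hS : IsParentClosed p S) :
    IsPruferCode ((arcGraph p).comap Fin.rev) ((insert 0 S).image Fin.rev) (W.map Fin.rev) := by
  have hmem : ∀ (X : Finset (Fin (n + 1))) y, y ∈ X.image Fin.rev ↔ y.rev ∈ X := by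
    intro X y
    rw [Finset.mem_image]
    exact ⟨by rintro ⟨x, hx, rfl⟩; rwa [Fin.rev_rev], fun h => ⟨_, h, Fin.rev_rev _⟩⟩
  induction h with
  | nil S hc _ =>
    refine .done _ (Finset.card_image_le.trans ((Finset.card_insert_le _ _).trans ?_))
    omega
  | cons S u W hc hu _ ih =>
    have huS := hu.1.1
    have hu0 := hS.ne_zero huS
    have hchild : ∀ x ∈ S, p x ≠ u := fun x hx hxu =>
      hu.1.2 x hx (.single (mem_arcsOf.2 ⟨hS.ne_zero hx, hxu.symm⟩))
    have hleaf : ∀ x ∈ S, (∃! y, y ∈ (insert 0 S).image Fin.rev ∧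
        ((arcGraph p).comap Fin.rev).Adj x.rev y) ↔ x ∈ minimalVertices p S := by
      intro x hx
      rw [hS.mem_minimalVertices_iff hp hx]
      simp only [hmem, SimpleGraph.comap_adj, Fin.rev_rev]
      exact Fin.revPerm.bijective.existsUnique_iff
        (p := fun y => y ∈ insert 0 S ∧ (arcGraph p).Adj x y) |>.symm
    refine .remove _ u.rev (p u).rev _ ?_ ⟨⟨?_, (hleaf u huS).2 hu.1⟩, ?_⟩ ?_ ?_ ?_
    · rw [Finset.card_image_of_injective _ Fin.rev_injective,
        Finset.card_insert_of_notMem hS.zero_notMem]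
      omega
    · simp [huS]
    · rintro x ⟨hx, hx'⟩
      rw [hmem, Finset.mem_insert] at hx
      rw [← Fin.rev_le_rev, Fin.rev_rev]
      rcases hx with hx | hx
      · rw [hx]
        exact Fin.zero_le _
      · rw [← Fin.rev_rev x] at hx'
        exact hu.2 ((hleaf _ hx).1 hx')
    · rw [hmem, Fin.rev_rev, Finset.mem_insert]
      exact or_iff_not_imp_left.2 (hS.parent_mem u huS)
    · rw [SimpleGraph.comap_adj, Fin.rev_rev, Fin.rev_rev]
      exact hp.arcGraph_adj.2 (.inl ⟨hu0, rfl⟩)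
    · have := ih (hS.erase hchild)
      rwa [← Finset.erase_insert_of_ne hu0.symm, Finset.image_erase Fin.rev_injective] at this

lemma exists_pruferCode {T : SimpleGraph (Fin (n + 1))} (hT : T.IsTree) :
    ∃ W, PhiComputes (arcsToRoot T, validPairs (arcsToRoot T)) (starArcs n, W) ∧
      IsPruferCode (T.comap Fin.rev) Finset.univ (W.map Fin.rev) := by
  obtain ⟨p, hp, rfl⟩ := exists_isRooted_arcGraph_eq hT
  rw [hp.arcsToRoot_arcGraph]
  have hS : IsParentClosed p (Finset.univ.erase 0) := ⟨by simp, by simp⟩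
  obtain ⟨W, hW⟩ := exists_code hp _ hS.zero_notMem (by
    intro x hx
    obtain ⟨r, hr, hxr⟩ := hp.exists_root x (Finset.ne_of_mem_erase hx)
    rw [mem_rootsOf] at hr
    exact ⟨r, by simp [hr.1], hr.2, hxr⟩)
  refine ⟨W, ?_, ?_⟩
  · rw [← arcsOf_eq_starArcs (p := cut p (Finset.univ.erase 0))
      fun u hu => cut_of_mem (by simp [hu])]
    refine hW.phiComputes hp ?_
    ext u
    rw [mem_phiInit_S, mem_validPairs_arcsOf]
    simp only [Finset.mem_erase, Finset.mem_univ]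
    tauto
  · have := hW.isPruferCode hp hS
    rwa [Finset.insert_erase (Finset.mem_univ _),
      Finset.image_univ_of_surjective Fin.rev_surjective] at this

end ForestReciprocity

theorem mainTheorem1 (n : ℕ) :
    (∀ G : SimpleGraph (Fin n),
      ∃ (φ : setA G → setB G) (ψ : setB G → setA G),
        (∀ a : setA G, PhiComputes (a : Arcs n × Arcs n) (φ a)) ∧
        (∀ b : setB G, PsiComputes (b : Arcs n × List (Fin (n + 1))) (ψ b)) ∧
        Function.LeftInverse ψ φ ∧ Function.RightInverse ψ φ) ∧
    -- the case of the complete graph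
    (∀ D O : Arcs n, (D, O) ∈ setA (⊤ : SimpleGraph (Fin n)) ↔
      IsRootedTree (⊤ : SimpleGraph (Fin n)) D ∧ O = validPairs D) ∧
    (∀ (D : Arcs n) (W : List (Fin (n + 1))), (D, W) ∈ setB (⊤ : SimpleGraph (Fin n)) ↔
      D = starArcs n ∧ W.length = n - 1) ∧
    (∀ T : SimpleGraph (Fin (n + 1)), T.IsTree →
      (arcsToRoot T, validPairs (arcsToRoot T)) ∈ setA (⊤ : SimpleGraph (Fin n)) ∧
      ∃ W : List (Fin (n + 1)),
        PhiComputes (arcsToRoot T, validPairs (arcsToRoot T)) (starArcs n, W) ∧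
        IsPruferCode (T.comap Fin.rev) Finset.univ (W.map Fin.rev)) := by
  refine ⟨fun G => ?_, fun D O => and_congr_right fun _ => isOperationalSet_top_iff,
    fun D W => mem_setB_top_iff, fun T hT => ⟨⟨?_, isOperationalSet_top_iff.2 rfl⟩,
      exists_pruferCode hT⟩⟩
  · choose φ hφ hφ₁ hφ₂ using fun a : setA G => exists_encoding a.2
    choose ψ hψ hψ₁ hψ₂ using fun b : setB G => exists_decoding b.2
    exact ⟨fun a => ⟨φ a, hφ a⟩, fun b => ⟨ψ b, hψ b⟩, hφ₁, hψ₁,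
      fun a => Subtype.ext (Computes.unique (hψ₁ _) (hφ₂ a)),
      fun b => Subtype.ext (Computes.unique (hφ₁ _) (hψ₂ b))⟩
  · obtain ⟨p, hp, rfl⟩ := exists_isRooted_arcGraph_eq hT
    rw [hp.arcsToRoot_arcGraph]
    exact isRootedTree_top_arcsOf hp
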